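/- Let $(E,\|\cdot\|_E)$ be a real Banach space with continuous dual $E'$, and let $B_{E'}=\{f\in E' : \|f\|_{E'}\le 1\}$ be the closed unit ball of $E'$. Let $M\in\mathbb{N}$, $x_1,\dots,x_M\in E$, and let $(z_j)_{j=1}^M$ be, on a probability space with expectation $\mathbb{E}$, either a Rademacher family (independent random variables with values in $\{-1,1\}$, each value being taken with probability $1/2$) or an orthogaussian family (independent standard Gaussian real random variables). Set $C_z:=1$ in the Rademacher case and $C_z:=2$ in the orthogaussian case. Let $G\colon[0,\infty)\to[0,\infty)$ be convex and increasing (not necessarily strictly). Then the following inequalities hold in $[0,\infty]$. (i) For all integers $k_1,\dots,k_M\ge 1$, $$\mathbb{E}\, G\Bigl(\sup_{f\in B_{E'}}\Bigl|\sum_{j=1}^M z_j f(x_j)^{k_j}\Bigr|\Bigr)\le \mathbb{E}\, G\Bigl(2C_z\Bigl\|\sum_{j=1}^M z_j k_j\|x_j\|_E^{k_j-1}x_j\Bigr\|_E\Bigr).$$ (ii) For all real exponents $q_1,\dots,q_M\in[1,\infty)$, $$\mathbb{E}\, G\Bigl(\sup_{f\in B_{E'}}\Bigl|\sum_{j=1}^M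 z_j |f(x_j)|^{q_j}\Bigr|\Bigr)\le \mathbb{E}\, G\Bigl(2C_z\Bigl\|\sum_{j=1}^M z_j q_j\|x_j\|_E^{q_j-1}x_j\Bigr\|_E\Bigr).$$ Here $0^0:=1$. -/

import Mathlib

open MeasureTheory ProbabilityTheory

/-- A Rademacher family: independent random variables with values in `{-1, 1}`, each of the two
values being taken with probability `1 / 2`. -/
structure IsRademacherFamily {Ω ι : Type*} [MeasurableSpace Ω] (r : ι → Ω → ℝ) (P : Measure Ω) :
    Prop where
  measurable : ∀ j, Measurable (r j)
  values : ∀ j ω, r j ω = -1 ∨ r j ω = 1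
  prob_neg_one : ∀ j, P {ω | r j ω = -1} = 1 / 2
  prob_one : ∀ j, P {ω | r j ω = 1} = 1 / 2
  indep : iIndepFun r P

/-- An orthogaussian family: independent standard Gaussian real random variables. -/
structure IsOrthogaussianFamily {Ω ι : Type*} [MeasurableSpace Ω] (g : ι → Ω → ℝ) (P : Measure Ω) :
    Prop where
  measurable : ∀ j, Measurable (g j)
  law : ∀ j, P.map (g j) = gaussianReal 0 1
  indep : iIndepFun g P

/-!
By symmetry and independence, `(z j)` and `(ε j • z j)` have the same law for all signs `ε`, so it
suffices to compare averages over the signs for fixed weights `w j` in place of `z j`. That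
comparison is the Ledoux–Talagrand contraction principle. If the increments of `u` are dominated by
those of `v`, then the two suprema of `h ± v` weakly majorize those of `h ± u`, and a convex
increasing function respects weak majorization (Tomić's inequality); the coordinates of a signed sum
can therefore be replaced one at a time. Taking absolute values inside the supremum costs the
factor `2`.

If `f` lies in the dual unit ball, then `|f (x j)| ≤ ‖x j‖`, and on `[-‖x j‖, ‖x j‖]` the functions
`t ↦ t ^ k` and `t ↦ |t| ^ q` have Lipschitz constants `k * ‖x j‖ ^ (k - 1)` and
`q * ‖x j‖ ^ (q - 1)`. Contraction to the corresponding linear functions leaves the supremum of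
`|f y|` for a single vector `y`, which is at most `‖y‖`.
-/

section TwoPoint

variable {I : Type*} {G : ℝ → ℝ}

theorem add_le_add_of_weakMajorization (hc : ConvexOn ℝ Set.univ G) (hm : Monotone G)
    {a b A B : ℝ} (ha : a ≤ max A B) (hb : b ≤ max A B) (hsum : a + b ≤ A + B) :
    G a + G b ≤ G A + G B := by
  wlog hBA : B ≤ A generalizing A B
  · rw [add_comm (G A)]
    exact this (by rwa [max_comm]) (by rwa [max_comm]) (by rwa [add_comm B]) (le_of_not_ge hBA)
  wlog hba : b ≤ a generalizing a b
  · rw [add_comm (G a)]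
    exact this hb ha (by rwa [add_comm b]) (le_of_not_ge hba)
  rw [max_eq_left hBA] at ha
  obtain hbB | hBb := le_or_gt b B
  · exact add_le_add (hm ha) (hm hbB)
  -- `b` and its reflection `A + B - b` are complementary convex combinations of `A` and `B`.
  obtain ⟨s, t, hs, ht, hst, rfl⟩ : b ∈ segment ℝ A B := by
    rw [segment_symm, segment_eq_Icc hBA]
    exact ⟨hBb.le, hba.trans ha⟩
  simp only [smul_eq_mul] at hsum ⊢
  calc G a + G (s * A + t * B)
      ≤ G (t * A + s * B) + G (s * A + t * B) := by
        gcongr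
        exact hm (by linear_combination hsum - (A + B) * hst)
    _ ≤ (t * G A + s * G B) + (s * G A + t * G B) :=
        add_le_add (hc.2 trivial trivial ht hs (by rwa [add_comm]))
          (hc.2 trivial trivial hs ht hst)
    _ = G A + G B := by linear_combination (G A + G B) * hst

theorem add_iSup_le_add_iSup [Nonempty I] (hc : ConvexOn ℝ Set.univ G) (hm : Monotone G)
    {h u v : I → ℝ} (hle : ∀ i, |u i| ≤ |v i|) (hdiff : ∀ i i', |u i - u i'| ≤ |v i - v i'|)
    (hadd : BddAbove (Set.range fun i => h i + v i))
    (hsub : BddAbove (Set.range fun i => h i - v i)) :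
    G (⨆ i, (h i + u i)) + G (⨆ i, (h i - u i)) ≤
      G (⨆ i, (h i + v i)) + G (⨆ i, (h i - v i)) := by
  have le_add := le_ciSup hadd
  have le_sub := le_ciSup hsub
  have add_abs_le (i : I) : h i + |v i| ≤ max (⨆ i, (h i + v i)) (⨆ i, (h i - v i)) := by
    rcases abs_choice (v i) with hv | hv
    · exact le_max_of_le_left (by rw [hv]; exact le_add i)
    · exact le_max_of_le_right (by rw [hv, ← sub_eq_add_neg]; exact le_sub i)
  refine add_le_add_of_weakMajorization hc hm
    (ciSup_le fun i => ?_) (ciSup_le fun i => ?_) (ciSup_add_ciSup_le fun i i' => ?_)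
  · linarith [le_abs_self (u i), hle i, add_abs_le i]
  · linarith [neg_abs_le (u i), hle i, add_abs_le i]
  · have hu : u i - u i' ≤ |v i - v i'| := (le_abs_self _).trans (hdiff i i')
    rcases abs_choice (v i - v i') with hv | hv
    · linarith [le_add i, le_sub i']
    · linarith [le_add i', le_sub i]

end TwoPoint

section Signs

theorem sum_le_sum_of_add_perm_le {α : Type*} [Fintype α] (σ : Equiv.Perm α) {Φ Ψ : α → ℝ}
    (h : ∀ a, Φ a + Φ (σ a) ≤ Ψ a + Ψ (σ a)) : ∑ a, Φ a ≤ ∑ a, Ψ a := by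
  have hsum : ∑ a, (Φ a + Φ (σ a)) ≤ ∑ a, (Ψ a + Ψ (σ a)) := Finset.sum_le_sum fun a _ => h a
  simp only [Finset.sum_add_distrib, Equiv.sum_comp] at hsum
  linarith

variable {ι I : Type*} [Fintype ι]

theorem abs_sum_units_smul_le {c K : ι → ℝ} (hK : ∀ j, |c j| ≤ K j) (ε : ι → ℤˣ) :
    |∑ j, ε j • c j| ≤ ∑ j, K j :=
  (Finset.abs_sum_le_sum_abs _ _).trans <| Finset.sum_le_sum fun j _ =>
    (norm_units_zsmul (ε j) (c j)).trans_le (hK j)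

theorem bddAbove_range_sum_units_smul {c : ι → I → ℝ} {K : ι → ℝ} (hK : ∀ j i, |c j i| ≤ K j)
    (ε : ι → ℤˣ) : BddAbove (Set.range fun i => ∑ j, ε j • c j i) :=
  ⟨∑ j, K j, Set.forall_mem_range.2 fun i =>
    (le_abs_self _).trans (abs_sum_units_smul_le (fun j => hK j i) ε)⟩

variable [DecidableEq ι]

theorem sum_mulSingle_neg_one_mul_smul (ε : ι → ℤˣ) (l : ι) (c : ι → ℝ) :
    ∑ j, (Pi.mulSingle l (-1) * ε : ι → ℤˣ) j • c j =
      ∑ j ∈ Finset.univ.erase l, ε j • c j - ε l • c l := by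
  rw [← Finset.sum_erase_add _ _ (Finset.mem_univ l), sub_eq_add_neg]
  congr 1
  · refine Finset.sum_congr rfl fun j hj => ?_
    simp [Finset.ne_of_mem_erase hj]
  · simp [Units.neg_smul]

variable {G : ℝ → ℝ} [Nonempty I] {u v : ι → I → ℝ} {K : ι → ℝ}

theorem sum_signs_iSup_le_of_eq_of_ne (hc : ConvexOn ℝ Set.univ G) (hm : Monotone G) (l : ι)
    (heq : ∀ j ≠ l, u j = v j) (hle : ∀ i, |u l i| ≤ |v l i|)
    (hdiff : ∀ i i', |u l i - u l i'| ≤ |v l i - v l i'|) (hK : ∀ j i, |v j i| ≤ K j) :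
    ∑ ε : ι → ℤˣ, G (⨆ i, ∑ j, ε j • u j i) ≤ ∑ ε : ι → ℤˣ, G (⨆ i, ∑ j, ε j • v j i) := by
  -- Pairing each `ε` with the signs flipped at `l` reduces the claim to two signs.
  refine sum_le_sum_of_add_perm_le (Equiv.mulLeft (Pi.mulSingle l (-1))) fun ε => ?_
  have hbdd := bddAbove_range_sum_units_smul hK ε
  have hbdd_flip := bddAbove_range_sum_units_smul hK (Pi.mulSingle l (-1) * ε)
  have hrest (i : I) : ∑ j ∈ Finset.univ.erase l, ε j • u j i =
      ∑ j ∈ Finset.univ.erase l, ε j • v j i :=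
    Finset.sum_congr rfl fun j hj => by rw [heq j (Finset.ne_of_mem_erase hj)]
  have hsplit (c : ι → ℝ) :
      ∑ j, ε j • c j = ∑ j ∈ Finset.univ.erase l, ε j • c j + ε l • c l :=
    (Finset.sum_erase_add _ _ (Finset.mem_univ l)).symm
  simp only [Equiv.coe_mulLeft, sum_mulSingle_neg_one_mul_smul, hsplit, hrest] at hbdd hbdd_flip ⊢
  have abs_smul (t : ℝ) : |ε l • t| = |t| := norm_units_zsmul (ε l) t
  exact add_iSup_le_add_iSup hc hm (by simpa only [abs_smul] using hle)
    (by simpa only [← smul_sub, abs_smul] using hdiff) hbdd hbdd_flip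

theorem sum_signs_iSup_le (hc : ConvexOn ℝ Set.univ G) (hm : Monotone G)
    (hle : ∀ j i, |u j i| ≤ |v j i|) (hdiff : ∀ j i i', |u j i - u j i'| ≤ |v j i - v j i'|)
    (hK : ∀ j i, |v j i| ≤ K j) :
    ∑ ε : ι → ℤˣ, G (⨆ i, ∑ j, ε j • u j i) ≤ ∑ ε : ι → ℤˣ, G (⨆ i, ∑ j, ε j • v j i) := by
  suffices replace : ∀ s : Finset ι, ∑ ε : ι → ℤˣ, G (⨆ i, ∑ j, ε j • u j i) ≤
      ∑ ε : ι → ℤˣ, G (⨆ i, ∑ j, ε j • s.piecewise v u j i) by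
    simpa only [Finset.piecewise_univ] using replace Finset.univ
  intro s
  induction s using Finset.induction_on with
  | empty => simp only [Finset.piecewise_empty, le_refl]
  | insert l s hl ih =>
    refine ih.trans (sum_signs_iSup_le_of_eq_of_ne (K := K) hc hm l
      (fun j hj => (Finset.piecewise_insert_of_ne _ _ _ hj).symm) ?_ ?_ fun j i => ?_)
    · simpa [hl] using hle l
    · simpa [hl] using hdiff l
    · by_cases hj : j ∈ insert l s
      · simpa only [Finset.piecewise_eq_of_mem _ _ _ hj] using hK j i
      · simpa only [Finset.piecewise_eq_of_notMem _ _ _ hj] using (hle j i).trans (hK j i)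

end Signs

section Truncation

variable {G : ℝ → ℝ} {c : ℝ}

-- A supremum without absolute values may be negative, while `G` is only controlled on `[0, ∞)`:
-- the truncation `max t 0` reconciles the two.
theorem monotone_comp_mul_max_zero (hm : MonotoneOn G (Set.Ici 0)) (hc₀ : 0 ≤ c) :
    Monotone fun t => G (c * max t 0) := fun s t hst =>
  hm (mul_nonneg hc₀ (le_max_right s 0)) (mul_nonneg hc₀ (le_max_right t 0)) (by gcongr)

theorem convexOn_comp_mul_max_zero (hc : ConvexOn ℝ (Set.Ici 0) G)
    (hm : MonotoneOn G (Set.Ici 0)) (hc₀ : 0 ≤ c) :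
    ConvexOn ℝ Set.univ fun t => G (c * max t 0) := by
  have hmem (t : ℝ) : c * max t 0 ∈ Set.Ici 0 := mul_nonneg hc₀ (le_max_right t 0)
  have hmax : ConvexOn ℝ Set.univ fun t : ℝ => c * max t 0 :=
    ((convexOn_id convex_univ).sup (convexOn_const 0 convex_univ)).smul hc₀
  refine ⟨convex_univ, fun s _ t _ a b ha hb hab => ?_⟩
  exact (hm (hmem _) (convex_Ici 0 (hmem s) (hmem t) ha hb hab)
    (hmax.2 trivial trivial ha hb hab)).trans (hc.2 (hmem s) (hmem t) ha hb hab)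

end Truncation

section AbsoluteValue

variable {ι I : Type*} [Fintype ι] [DecidableEq ι] [Nonempty I] {G : ℝ → ℝ} {u v : ι → I → ℝ}
  {K : ι → ℝ}

theorem sum_signs_iSup_abs_le_sum_signs_max_iSup (hc : ConvexOn ℝ (Set.Ici 0) G)
    (hm : MonotoneOn G (Set.Ici 0)) (hK : ∀ j i, |u j i| ≤ K j) :
    ∑ ε : ι → ℤˣ, G (⨆ i, |∑ j, ε j • u j i|) ≤
      ∑ ε : ι → ℤˣ, G (2 * max (⨆ i, ∑ j, ε j • u j i) 0) := by
  set S : (ι → ℤˣ) → ℝ := fun ε => ⨆ i, ∑ j, ε j • u j i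
  have sum_le (ε : ι → ℤˣ) (i : I) : ∑ j, ε j • u j i ≤ S ε :=
    le_ciSup (bddAbove_range_sum_units_smul hK ε) i
  have neg_sum_le (ε : ι → ℤˣ) (i : I) : -∑ j, ε j • u j i ≤ S (-ε) := by
    simpa [Units.neg_smul] using sum_le (-ε) i
  refine sum_le_sum_of_add_perm_le (Equiv.neg _) fun ε => ?_
  set s := max (S ε) 0
  set t := max (S (-ε)) 0
  have hs : 0 ≤ s := le_max_right _ _
  have ht : 0 ≤ t := le_max_right _ _
  have iSup_abs_le : ⨆ i, |∑ j, ε j • u j i| ≤ s + t := ciSup_le fun i => abs_le'.2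
    ⟨by linarith [sum_le ε i, le_max_left (S ε) 0],
      by linarith [neg_sum_le ε i, le_max_left (S (-ε)) 0]⟩
  have midpoint_le : G (s + t) ≤ 2⁻¹ * G (2 * s) + 2⁻¹ * G (2 * t) := by
    simpa using hc.2 (x := 2 * s) (by simpa) (y := 2 * t) (by simpa)
      (by norm_num : (0 : ℝ) ≤ 2⁻¹) (by norm_num : (0 : ℝ) ≤ 2⁻¹) (by norm_num)
  have hG : G (⨆ i, |∑ j, ε j • u j i|) ≤ G (s + t) :=
    hm (Real.iSup_nonneg fun i => abs_nonneg _) (add_nonneg hs ht) iSup_abs_le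
  have iSup_abs_neg : ⨆ i, |∑ j, (-ε) j • u j i| = ⨆ i, |∑ j, ε j • u j i| := by
    simp only [Pi.neg_apply, Units.neg_smul, Finset.sum_neg_distrib, abs_neg]
  rw [Equiv.neg_apply, iSup_abs_neg]
  change _ ≤ G (2 * s) + G (2 * t)
  linarith

theorem sum_signs_iSup_abs_le (hc : ConvexOn ℝ (Set.Ici 0) G) (hm : MonotoneOn G (Set.Ici 0))
    (hle : ∀ j i, |u j i| ≤ |v j i|) (hdiff : ∀ j i i', |u j i - u j i'| ≤ |v j i - v j i'|)
    (hK : ∀ j i, |v j i| ≤ K j) :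
    ∑ ε : ι → ℤˣ, G (⨆ i, |∑ j, ε j • u j i|) ≤
      ∑ ε : ι → ℤˣ, G (2 * ⨆ i, |∑ j, ε j • v j i|) := by
  have iSup_abs_nonneg (ε : ι → ℤˣ) : 0 ≤ ⨆ i, |∑ j, ε j • v j i| :=
    Real.iSup_nonneg fun i => abs_nonneg _
  have iSup_le_iSup_abs (ε : ι → ℤˣ) : ⨆ i, ∑ j, ε j • v j i ≤ ⨆ i, |∑ j, ε j • v j i| :=
    ciSup_mono ⟨∑ j, K j, Set.forall_mem_range.2 fun i => abs_sum_units_smul_le (fun j => hK j i) ε⟩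
      fun i => le_abs_self _
  calc ∑ ε : ι → ℤˣ, G (⨆ i, |∑ j, ε j • u j i|)
      ≤ ∑ ε : ι → ℤˣ, G (2 * max (⨆ i, ∑ j, ε j • u j i) 0) :=
        sum_signs_iSup_abs_le_sum_signs_max_iSup hc hm fun j i => (hle j i).trans (hK j i)
    _ ≤ ∑ ε : ι → ℤˣ, G (2 * max (⨆ i, ∑ j, ε j • v j i) 0) :=
        sum_signs_iSup_le (convexOn_comp_mul_max_zero hc hm zero_le_two)
          (monotone_comp_mul_max_zero hm zero_le_two) hle hdiff hK
    _ ≤ ∑ ε : ι → ℤˣ, G (2 * ⨆ i, |∑ j, ε j • v j i|) := by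
        refine Finset.sum_le_sum fun ε _ => hm (Set.mem_Ici.2 (by positivity))
          (mul_nonneg zero_le_two (iSup_abs_nonneg ε)) ?_
        gcongr
        exact max_le (iSup_le_iSup_abs ε) (iSup_abs_nonneg ε)

end AbsoluteValue

theorem lintegral_comp_le_of_sum_smul_le {Ω Γ X : Type*} [Fintype Γ] [Nonempty Γ] [SMul Γ X]
    [MeasurableSpace Ω] [MeasurableSpace X] {P : Measure Ω} {Z : Ω → X}
    (hZ : ∀ g : Γ, IdentDistrib (fun ω => g • Z ω) Z P P) {F₁ F₂ : X → ENNReal}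
    (hF₁ : Measurable F₁) (hF₂ : Measurable F₂)
    (hF : ∀ x, ∑ g : Γ, F₁ (g • x) ≤ ∑ g : Γ, F₂ (g • x)) :
    ∫⁻ ω, F₁ (Z ω) ∂P ≤ ∫⁻ ω, F₂ (Z ω) ∂P := by
  have lintegral_sum {F : X → ENNReal} (hF : Measurable F) :
      ∫⁻ ω, ∑ g : Γ, F (g • Z ω) ∂P = Fintype.card Γ * ∫⁻ ω, F (Z ω) ∂P := by
    have lintegral_smul (g : Γ) : ∫⁻ ω, F (g • Z ω) ∂P = ∫⁻ ω, F (Z ω) ∂P :=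
      ((hZ g).comp hF).lintegral_eq
    rw [lintegral_finsetSum' (f := fun g ω => F (g • Z ω)) _ fun g _ =>
      hF.comp_aemeasurable (hZ g).aemeasurable_fst]
    simp only [lintegral_smul, Finset.sum_const, Finset.card_univ, nsmul_eq_mul]
  have hcard : (Fintype.card Γ : ENNReal) ≠ 0 := Nat.cast_ne_zero.2 Fintype.card_ne_zero
  rw [← ENNReal.mul_le_mul_iff_right hcard (ENNReal.natCast_ne_top _),
    ← lintegral_sum hF₁, ← lintegral_sum hF₂]
  exact lintegral_mono fun ω => hF (Z ω)

section Symmetric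

variable {Ω ι : Type*} [MeasurableSpace Ω] {P : Measure Ω} {z : ι → Ω → ℝ}

theorem identDistrib_units_smul [Countable ι] (hind : iIndepFun z P)
    (hsymm : ∀ j, IdentDistrib (fun ω => -z j ω) (z j) P P) (ε : ι → ℤˣ) :
    IdentDistrib (fun ω => ε • fun j => z j ω) (fun ω j => z j ω) P P := by
  refine IdentDistrib.pi (X := fun j ω => ε j • z j ω) (fun j => ?_)
    (hind.comp (fun j t => ε j • t) fun j => by fun_prop) hind
  obtain hε | hε := Int.units_eq_one_or (ε j)
  · simpa only [hε, one_smul] using .refl (hsymm j).aemeasurable_snd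
  · simpa only [hε, Units.neg_smul, one_smul] using hsymm j

theorem IsRademacherFamily.map_eq (hz : IsRademacherFamily z P) (j : ι) :
    P.map (z j) = (1 / 2 : ENNReal) • (Measure.dirac (-1) + Measure.dirac 1) := by
  have hs : MeasurableSet {ω | z j ω = -1} := hz.measurable j (measurableSet_singleton _)
  have hcompl : {ω | z j ω = -1}ᶜ = {ω | z j ω = 1} := by
    ext ω
    obtain h | h := hz.values j ω <;> simp [h] <;> norm_num
  have map_restrict (t : ℝ) : (P.restrict {ω | z j ω = t}).map (z j) =
      P {ω | z j ω = t} • Measure.dirac t := by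
    have hconst : z j =ᵐ[P.restrict {ω | z j ω = t}] fun _ => t :=
      ae_restrict_mem (hz.measurable j (measurableSet_singleton t))
    rw [Measure.map_congr hconst, Measure.map_const, Measure.restrict_apply_univ]
  rw [← Measure.restrict_add_restrict_compl (μ := P) hs, Measure.map_add _ _ (hz.measurable j),
    hcompl, map_restrict, map_restrict, hz.prob_neg_one, hz.prob_one, smul_add]

theorem IsRademacherFamily.identDistrib_neg (hz : IsRademacherFamily z P) (j : ι) :
    IdentDistrib (fun ω => -z j ω) (z j) P P where
  aemeasurable_fst := (hz.measurable j).neg.aemeasurable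
  aemeasurable_snd := (hz.measurable j).aemeasurable
  map_eq := by
    change P.map (Neg.neg ∘ z j) = _
    rw [← Measure.map_map measurable_neg (hz.measurable j), hz.map_eq, Measure.map_smul,
      Measure.map_add _ _ measurable_neg, Measure.map_dirac' measurable_neg,
      Measure.map_dirac' measurable_neg, neg_neg, add_comm]

theorem IsOrthogaussianFamily.identDistrib_neg (hz : IsOrthogaussianFamily z P) (j : ι) :
    IdentDistrib (fun ω => -z j ω) (z j) P P where
  aemeasurable_fst := (hz.measurable j).neg.aemeasurable
  aemeasurable_snd := (hz.measurable j).aemeasurable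
  map_eq := by
    change P.map (Neg.neg ∘ z j) = _
    rw [← Measure.map_map measurable_neg (hz.measurable j), hz.law]
    exact gaussianReal_map_neg.trans (by rw [neg_zero])

end Symmetric

section Contraction

variable {Ω ι I : Type*} [Fintype ι] {G : ℝ → ℝ}

theorem measurable_ofReal_comp_of_monotoneOn {X : Type*} [MeasurableSpace X]
    (hm : MonotoneOn G (Set.Ici 0)) {f : X → ℝ} (hf : Measurable f) (hf₀ : ∀ x, 0 ≤ f x) :
    Measurable fun x => ENNReal.ofReal (G (f x)) := by
  have hG : Measurable fun t => G (1 * max t 0) :=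
    (monotone_comp_mul_max_zero hm zero_le_one).measurable
  simpa only [Function.comp_def, one_mul, max_eq_left (hf₀ _)] using (hG.comp hf).ennreal_ofReal

theorem measurable_iSup_abs_sum_mul {u : ι → I → ℝ} {K : ι → ℝ} (hK : ∀ j i, |u j i| ≤ K j) :
    Measurable fun w : ι → ℝ => ⨆ i, |∑ j, w j * u j i| := by
  refine (lowerSemicontinuous_ciSup (fun w => ⟨∑ j, |w j| * K j, ?_⟩) fun i =>
    Continuous.lowerSemicontinuous (by fun_prop)).measurable
  refine Set.forall_mem_range.2 fun i => (Finset.abs_sum_le_sum_abs _ _).trans ?_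
  simp only [abs_mul]
  gcongr with j
  exact hK j i

variable [MeasurableSpace Ω] {P : Measure Ω} {z : ι → Ω → ℝ}

theorem lintegral_ofReal_comp_mono (hm : MonotoneOn G (Set.Ici 0)) {f g : Ω → ℝ}
    (hf : ∀ ω, 0 ≤ f ω) (hfg : ∀ ω, f ω ≤ g ω) :
    ∫⁻ ω, ENNReal.ofReal (G (f ω)) ∂P ≤ ∫⁻ ω, ENNReal.ofReal (G (g ω)) ∂P :=
  lintegral_mono fun ω =>
    ENNReal.ofReal_le_ofReal (hm (hf ω) ((hf ω).trans (hfg ω)) (hfg ω))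

theorem lintegral_iSup_abs_sum_mul_le [Nonempty I] (hind : iIndepFun z P)
    (hsymm : ∀ j, IdentDistrib (fun ω => -z j ω) (z j) P P)
    (hG : ∀ t ∈ Set.Ici 0, 0 ≤ G t) (hc : ConvexOn ℝ (Set.Ici 0) G)
    (hm : MonotoneOn G (Set.Ici 0)) {u v : ι → I → ℝ} {K : ι → ℝ}
    (hle : ∀ j i, |u j i| ≤ |v j i|) (hdiff : ∀ j i i', |u j i - u j i'| ≤ |v j i - v j i'|)
    (hK : ∀ j i, |v j i| ≤ K j) :
    ∫⁻ ω, ENNReal.ofReal (G (⨆ i, |∑ j, z j ω * u j i|)) ∂P ≤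
      ∫⁻ ω, ENNReal.ofReal (G (2 * ⨆ i, |∑ j, z j ω * v j i|)) ∂P := by
  classical
  have iSup_nonneg (c : ι → I → ℝ) (w : ι → ℝ) : 0 ≤ ⨆ i, |∑ j, w j * c j i| :=
    Real.iSup_nonneg fun i => abs_nonneg _
  have two_mul_iSup_nonneg (w : ι → ℝ) : 0 ≤ 2 * ⨆ i, |∑ j, w j * v j i| :=
    mul_nonneg zero_le_two (iSup_nonneg v w)
  refine lintegral_comp_le_of_sum_smul_le (Z := fun ω j => z j ω)
    (F₁ := fun w => ENNReal.ofReal (G (⨆ i, |∑ j, w j * u j i|)))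
    (F₂ := fun w => ENNReal.ofReal (G (2 * ⨆ i, |∑ j, w j * v j i|)))
    (identDistrib_units_smul hind hsymm)
    (measurable_ofReal_comp_of_monotoneOn hm
      (measurable_iSup_abs_sum_mul fun j i => (hle j i).trans (hK j i)) (iSup_nonneg u))
    (measurable_ofReal_comp_of_monotoneOn hm ((measurable_iSup_abs_sum_mul hK).const_mul 2)
      two_mul_iSup_nonneg) fun w => ?_
  rw [← ENNReal.ofReal_sum_of_nonneg fun ε _ => hG _ (iSup_nonneg u (ε • w)),
    ← ENNReal.ofReal_sum_of_nonneg fun ε _ => hG _ (two_mul_iSup_nonneg (ε • w))]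
  simp only [Pi.smul_apply', smul_mul_assoc]
  refine ENNReal.ofReal_le_ofReal
    (sum_signs_iSup_abs_le (K := fun j => |w j| * K j) hc hm ?_ ?_ ?_)
  · intro j i
    simpa only [abs_mul] using mul_le_mul_of_nonneg_left (hle j i) (abs_nonneg (w j))
  · intro j i i'
    simpa only [← mul_sub, abs_mul] using
      mul_le_mul_of_nonneg_left (hdiff j i i') (abs_nonneg (w j))
  · intro j i
    simpa only [abs_mul] using mul_le_mul_of_nonneg_left (hK j i) (abs_nonneg (w j))

end Contraction

section PowerEstimates

variable {q R s t : ℝ}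

theorem abs_pow_sub_pow_le_mul (k : ℕ) (hs : |s| ≤ R) (ht : |t| ≤ R) :
    |s ^ k - t ^ k| ≤ k * R ^ (k - 1) * |s - t| :=
  calc |s ^ k - t ^ k| ≤ |s - t| * k * max |s| |t| ^ (k - 1) := abs_pow_sub_pow_le s t k
    _ ≤ |s - t| * k * R ^ (k - 1) := by gcongr; exact max_le hs ht
    _ = k * R ^ (k - 1) * |s - t| := by ring

theorem abs_rpow_sub_rpow_le_mul (hq : 1 ≤ q) (hs : s ∈ Set.Icc 0 R)
    (ht : t ∈ Set.Icc 0 R) : |s ^ q - t ^ q| ≤ q * R ^ (q - 1) * |s - t| := by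
  refine (convex_Icc 0 R).norm_image_sub_le_of_norm_hasDerivWithin_le
    (fun y _ => (Real.hasDerivAt_rpow_const (.inr hq)).hasDerivWithinAt) (fun y hy => ?_) ht hs
  rw [Real.norm_of_nonneg (mul_nonneg (by linarith) (Real.rpow_nonneg hy.1 _))]
  gcongr
  exacts [hy.1, hy.2]

theorem abs_abs_rpow_sub_abs_rpow_le_mul (hq : 1 ≤ q) (hs : |s| ≤ R)
    (ht : |t| ≤ R) : |(|s| ^ q) - |t| ^ q| ≤ q * R ^ (q - 1) * |s - t| := by
  have hR : 0 ≤ R := (abs_nonneg s).trans hs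
  exact (abs_rpow_sub_rpow_le_mul hq ⟨abs_nonneg s, hs⟩ ⟨abs_nonneg t, ht⟩).trans
    (mul_le_mul_of_nonneg_left (abs_abs_sub_abs_le s t) (by positivity))

end PowerEstimates

section DualBall

variable {E Ω ι : Type*} [SeminormedAddCommGroup E] [NormedSpace ℝ E]

theorem abs_apply_le_norm_of_mem_closedBall (f : Metric.closedBall (0 : StrongDual ℝ E) 1)
    (y : E) : |(f : StrongDual ℝ E) y| ≤ ‖y‖ := by
  simpa only [one_mul, Real.norm_eq_abs] using
    (f : StrongDual ℝ E).le_of_opNorm_le (mem_closedBall_zero_iff.1 f.2) y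

variable [Fintype ι] [MeasurableSpace Ω] {P : Measure Ω} {z : ι → Ω → ℝ} {x : ι → E} {G : ℝ → ℝ}

theorem lintegral_iSup_dualBall_le (hind : iIndepFun z P)
    (hsymm : ∀ j, IdentDistrib (fun ω => -z j ω) (z j) P P)
    (hG : ∀ t ∈ Set.Ici 0, 0 ≤ G t) (hc : ConvexOn ℝ (Set.Ici 0) G)
    (hm : MonotoneOn G (Set.Ici 0)) {φ : ι → ℝ → ℝ} {a : ι → ℝ} (hφ₀ : ∀ j, φ j 0 = 0)
    (hφ : ∀ j s t, |s| ≤ ‖x j‖ → |t| ≤ ‖x j‖ → |φ j s - φ j t| ≤ a j * |s - t|)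
    (ha : ∀ j, 0 ≤ a j) :
    ∫⁻ ω, ENNReal.ofReal (G (⨆ f : Metric.closedBall (0 : StrongDual ℝ E) 1,
        |∑ j, z j ω * φ j ((f : StrongDual ℝ E) (x j))|)) ∂P ≤
      ∫⁻ ω, ENNReal.ofReal (G (2 * ‖∑ j, (z j ω * a j) • x j‖)) ∂P := by
  have : Nonempty (Metric.closedBall (0 : StrongDual ℝ E) 1) :=
    (Metric.nonempty_closedBall.2 zero_le_one).to_subtype
  have abs_mul_apply (j : ι) (t : ℝ) : |a j * t| = a j * |t| := by
    rw [abs_mul, abs_of_nonneg (ha j)]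
  have hball := abs_apply_le_norm_of_mem_closedBall (E := E)
  refine (lintegral_iSup_abs_sum_mul_le (K := fun j => a j * ‖x j‖)
    (v := fun j (f : Metric.closedBall (0 : StrongDual ℝ E) 1) =>
      a j * (f : StrongDual ℝ E) (x j)) hind hsymm hG hc hm ?_ ?_ ?_).trans
    (lintegral_ofReal_comp_mono hm
      (fun ω => mul_nonneg zero_le_two (Real.iSup_nonneg fun f => abs_nonneg _)) fun ω => ?_)
  · intro j f
    simpa only [abs_mul_apply, hφ₀, sub_zero] using hφ j _ 0 (hball f _) (by simp)
  · intro j f g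
    simpa only [← mul_sub, abs_mul_apply] using hφ j _ _ (hball f _) (hball g _)
  · intro j f
    simpa only [abs_mul_apply] using mul_le_mul_of_nonneg_left (hball f _) (ha j)
  · gcongr
    refine ciSup_le fun f => ?_
    simpa only [map_sum, map_smul, smul_eq_mul, mul_assoc] using
      hball f (∑ j, (z j ω * a j) • x j)

theorem mainTheorem5_general (hind : iIndepFun z P)
    (hsymm : ∀ j, IdentDistrib (fun ω => -z j ω) (z j) P P)
    (hG : ∀ t ∈ Set.Ici 0, 0 ≤ G t) (hc : ConvexOn ℝ (Set.Ici 0) G)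
    (hm : MonotoneOn G (Set.Ici 0)) {C : ℝ} (hC : 1 ≤ C) :
    (∀ k : ι → ℕ, (∀ j, 1 ≤ k j) →
      ∫⁻ ω, ENNReal.ofReal (G (⨆ f : Metric.closedBall (0 : StrongDual ℝ E) 1,
          |∑ j, z j ω * (f : StrongDual ℝ E) (x j) ^ k j|)) ∂P
        ≤ ∫⁻ ω, ENNReal.ofReal (G (2 * C *
            ‖∑ j, (z j ω * (k j : ℝ) * ‖x j‖ ^ (k j - 1)) • x j‖)) ∂P) ∧
    (∀ q : ι → ℝ, (∀ j, 1 ≤ q j) →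
      ∫⁻ ω, ENNReal.ofReal (G (⨆ f : Metric.closedBall (0 : StrongDual ℝ E) 1,
          |∑ j, z j ω * |(f : StrongDual ℝ E) (x j)| ^ q j|)) ∂P
        ≤ ∫⁻ ω, ENNReal.ofReal (G (2 * C *
            ‖∑ j, (z j ω * q j * ‖x j‖ ^ (q j - 1)) • x j‖)) ∂P) := by
  have hscale (a : ι → ℝ) : ∫⁻ ω, ENNReal.ofReal (G (2 * ‖∑ j, (z j ω * a j) • x j‖)) ∂P ≤
      ∫⁻ ω, ENNReal.ofReal (G (2 * C * ‖∑ j, (z j ω * a j) • x j‖)) ∂P :=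
    lintegral_ofReal_comp_mono hm (fun ω => by positivity) fun ω => by gcongr; linarith
  simp only [mul_assoc (z _ _)]
  refine ⟨fun k hk => (hscale _).trans' ?_, fun q hq => (hscale _).trans' ?_⟩
  · exact lintegral_iSup_dualBall_le hind hsymm hG hc hm (φ := fun j t => t ^ k j)
      (fun j => zero_pow (Nat.one_le_iff_ne_zero.1 (hk j)))
      (fun j s t => abs_pow_sub_pow_le_mul (k j)) fun j => by positivity
  · have hq₀ (j : ι) : 0 < q j := one_pos.trans_le (hq j)
    exact lintegral_iSup_dualBall_le hind hsymm hG hc hm (φ := fun j t => |t| ^ q j)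
      (fun j => by rw [abs_zero, Real.zero_rpow (hq₀ j).ne'])
      (fun j s t => abs_abs_rpow_sub_abs_rpow_le_mul (hq j)) fun j =>
        mul_nonneg (hq₀ j).le (Real.rpow_nonneg (norm_nonneg _) _)

end DualBall

theorem mainTheorem5
    {E : Type*} [NormedAddCommGroup E] [NormedSpace ℝ E]
    {Ω : Type*} [MeasurableSpace Ω] (P : Measure Ω) [IsProbabilityMeasure P]
    (M : ℕ) (x : Fin M → E) (z : Fin M → Ω → ℝ) (C : ℝ)
    (hz : (IsRademacherFamily z P ∧ C = 1) ∨ (IsOrthogaussianFamily z P ∧ C = 2))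
    (G : ℝ → ℝ) (hG_nonneg : ∀ t ∈ Set.Ici (0 : ℝ), 0 ≤ G t)
    (hG_convex : ConvexOn ℝ (Set.Ici (0 : ℝ)) G) (hG_mono : MonotoneOn G (Set.Ici (0 : ℝ))) :
    (∀ k : Fin M → ℕ, (∀ j, 1 ≤ k j) →
      ∫⁻ ω, ENNReal.ofReal (G (⨆ f : Metric.closedBall (0 : StrongDual ℝ E) 1,
          |∑ j, z j ω * (f : StrongDual ℝ E) (x j) ^ k j|)) ∂P
        ≤ ∫⁻ ω, ENNReal.ofReal (G (2 * C *
            ‖∑ j, (z j ω * (k j : ℝ) * ‖x j‖ ^ (k j - 1)) • x j‖)) ∂P) ∧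
    (∀ q : Fin M → ℝ, (∀ j, 1 ≤ q j) →
      ∫⁻ ω, ENNReal.ofReal (G (⨆ f : Metric.closedBall (0 : StrongDual ℝ E) 1,
          |∑ j, z j ω * |(f : StrongDual ℝ E) (x j)| ^ q j|)) ∂P
        ≤ ∫⁻ ω, ENNReal.ofReal (G (2 * C *
            ‖∑ j, (z j ω * q j * ‖x j‖ ^ (q j - 1)) • x j‖)) ∂P) := by
  obtain ⟨hz, rfl⟩ | ⟨hz, rfl⟩ := hz <;>
    exact mainTheorem5_general hz.indep hz.identDistrib_neg hG_nonneg hG_convex hG_mono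
      (by norm_num)
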